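/- Let $\mathfrak g$ and $\mathfrak h$ be Lie algebras (of arbitrary dimension) over a field, let $Z(\mathfrak h)$ be the center of $\mathfrak h$, and let $$\bar\alpha:\mathfrak g\to \operatorname{out}(\mathfrak h)=\operatorname{der}(\mathfrak h)/\operatorname{ad}(\mathfrak h)$$ be a Lie algebra homomorphism. Derivations of $\mathfrak h$ preserve $Z(\mathfrak h)$ and inner ones vanish on it, so $Z(\mathfrak h)$ is a $\mathfrak g$-module via $\bar\alpha$; let $H^n(\mathfrak g;Z(\mathfrak h))$ be its Chevalley cohomology. For a linear map $\alpha:\mathfrak g\to\operatorname{der}(\mathfrak h)$ and an alternating bilinear map $\rho:\mathfrak g\times\mathfrak g\to\mathfrak h$ put $$(\delta_\alpha\rho)(X,Y,Z)=\sum_{\text{cyclic}\{X,Y,Z\}}\bigl(\alpha_X\rho(Y,Z)-\rho([X,Y],Z)\bigr).$$ Call $(\alpha,\rho)$ admissible if $\alpha$ is a linear lift of $\bar\alpha$ and $[\alpha_X,\alpha_Y]-\alpha_{[X,Y]}=\operatorname{ad}_{\rho(X,Y)}$ for all $X,Y\in\mathfrak g$. An extension $0\to\mathfrak h\xrightarrow{i}\mathfrak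 e\xrightarrow{p}\mathfrak g\to0$ of Lie algebras induces $\bar\alpha$ if, for every $x\in\mathfrak e$, the derivation $[x,\cdot]$ of the ideal $i(\mathfrak h)\cong\mathfrak h$ has class $\bar\alpha(p(x))$ in $\operatorname{out}(\mathfrak h)$. Two extensions are equivalent if there is a Lie algebra homomorphism $\mathfrak e\to\mathfrak e'$ compatible with the identity maps of $\mathfrak h$ and $\mathfrak g$. (a) Linear lifts $\alpha$ of $\bar\alpha$ exist, and for each of them there is $\rho$ such that $(\alpha,\rho)$ is admissible. For every admissible $(\alpha,\rho)$ the alternating map $\lambda(\alpha,\rho):=\delta_\alpha\rho$ takes values in $Z(\mathfrak h)$ and is a $3$-cocycle, and its class in $H^3(\mathfrak g;Z(\mathfrak h))$ is the same for all admissible $(\alpha,\rho)$. (b) The following are equivalent: (1) $[\lambda(\alpha,\rho)]=0$ in $H^3(\mathfrak g;Z(\mathfrak h))$ for one admissible pair $(\alpha,\rho)$; (1$'$) $[\lambda(\alpha,\rho)]=0$ for every admissible pair $(\alpha,\rho)$; (2) there exists an extension $0\to\mathfrak h\to\mathfrak e\to\mathfrak g\to0$ inducing $\bar\alpha$. (c)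 If this is the case, then the equivalence classes of extensions inducing $\bar\alpha$ are parametrized by $H^2(\mathfrak g;Z(\mathfrak h))$ in the following sense. For every linear lift $\alpha$ of $\bar\alpha$ there is $\rho$ with $(\alpha,\rho)$ admissible and $\delta_\alpha\rho=0$; and for every admissible $(\alpha,\rho)$ with $\delta_\alpha\rho=0$ there is a bijection $\Phi$ from $H^2(\mathfrak g;Z(\mathfrak h))$ onto the set of these equivalence classes such that, for every $2$-cocycle $\mu$ and every extension $\mathfrak e$ inducing $\bar\alpha$, $\Phi([\mu])$ is the class of $\mathfrak e$ if and only if $p$ has a linear section $s$ with $[s(X),i(H)]=i(\alpha_XH)$ and $[s(X),s(Y)]-s([X,Y])=i\bigl(\rho(X,Y)-\mu(X,Y)\bigr)$ for all $X,Y\in\mathfrak g$, $H\in\mathfrak h$. -/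

import Mathlib

/-! ## Derivations, outer derivations and the centre -/

namespace LieExt

section Out

variable (K : Type*) [Field K] (h : Type*) [LieRing h] [LieAlgebra K h]

/-- The Lie algebra of outer derivations `out(h) = der(h) / ad(h)`. -/
abbrev Out : Type _ := LieDerivation K h h ⧸ (LieDerivation.ad K h).idealRange

variable {K h}

theorem derivation_mem_center (D : LieDerivation K h h) {z : h}
    (hz : z ∈ LieAlgebra.center K h) : D z ∈ LieAlgebra.center K h := by
  rw [LieModule.mem_maxTrivSubmodule] at hz ⊢
  intro x
  have h1 := D.apply_lie_eq_add x z
  rw [hz x, hz (D x), map_zero, add_zero] at h1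
  exact h1.symm

variable (K h)

/-- A derivation of `h` restricted to the centre `Z(h)`. -/
def derCenter : LieDerivation K h h →ₗ[K] Module.End K (LieAlgebra.center K h) where
  toFun D :=
    { toFun := fun z => ⟨D z, derivation_mem_center D z.2⟩
      map_add' := fun x y => Subtype.ext (by simp)
      map_smul' := fun c x => Subtype.ext (by simp) }
  map_add' D E := by ext; simp
  map_smul' c D := by ext; simp

@[simp] theorem coe_derCenter_apply (D : LieDerivation K h h) (z : LieAlgebra.center K h) :
    (derCenter K h D z : h) = D z := rfl

/-- The action of `out(h)` on `Z(h)`: the class of `D` acts as `D`. This is well defined because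
inner derivations vanish on the centre. -/
def outCenter : Out K h →ₗ[K] Module.End K (LieAlgebra.center K h) :=
  Submodule.liftQ (LieDerivation.ad K h).idealRange.toSubmodule (derCenter K h) (by
    intro D hD
    obtain ⟨x, rfl⟩ := LieDerivation.mem_ad_idealRange_iff.mp hD
    rw [LinearMap.mem_ker]
    ext z
    have hz := (LieModule.mem_maxTrivSubmodule (R := K) (L := h) (M := h) z.1).mp z.2 x
    simpa using hz)

@[simp] theorem outCenter_mk (D : LieDerivation K h h) :
    outCenter K h (LieSubmodule.Quotient.mk D) = derCenter K h D := rfl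

end Out

section CenterAction

variable {K : Type*} [Field K] {g h : Type*} [LieRing g] [LieAlgebra K g] [LieRing h]
  [LieAlgebra K h]

/-- The `g`-module structure on `Z(h)` given by a homomorphism `g → out(h)`. -/
def centerAction (abar : g →ₗ⁅K⁆ Out K h) : g →ₗ[K] Module.End K (LieAlgebra.center K h) :=
  outCenter K h ∘ₗ (abar : g →ₗ[K] Out K h)

/-- `centerAction abar` is a representation of `g`. -/
theorem centerAction_lie (abar : g →ₗ⁅K⁆ Out K h) (X Y : g) (z : LieAlgebra.center K h) :
    centerAction abar ⁅X, Y⁆ z =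
      centerAction abar X (centerAction abar Y z) - centerAction abar Y (centerAction abar X z) := by
  obtain ⟨D, hD⟩ := LieSubmodule.Quotient.surjective_mk' _ (abar X)
  obtain ⟨E, hE⟩ := LieSubmodule.Quotient.surjective_mk' _ (abar Y)
  have hX : centerAction abar X = derCenter K h D := by
    change outCenter K h (abar X) = _
    rw [← hD]; rfl
  have hY : centerAction abar Y = derCenter K h E := by
    change outCenter K h (abar Y) = _
    rw [← hE]; rfl
  have hXY : centerAction abar ⁅X, Y⁆ = derCenter K h ⁅D, E⁆ := by
    change outCenter K h (abar ⁅X, Y⁆) = _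
    rw [LieHom.map_lie, ← hD, ← hE]; rfl
  rw [hX, hY, hXY]
  ext
  simp

end CenterAction

/-! ## The Chevalley complex -/

section Chevalley

variable {K : Type*} [Field K] {g V : Type*} [LieRing g] [LieAlgebra K g] [AddCommGroup V]
  [Module K V]

/-- Over a field the bracket is the antisymmetrization of some bilinear map. -/
theorem exists_bilin_sub_eq_lie (K : Type*) [Field K] (g : Type*) [LieRing g] [LieAlgebra K g] :
    ∃ B : g →ₗ[K] g →ₗ[K] g, ∀ x y, B x y - B y x = ⁅x, y⁆ := by
  classical
  let b := Module.Basis.ofVectorSpace K g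
  let _ : LinearOrder (Module.Basis.ofVectorSpaceIndex K g) := linearOrderOfSTO WellOrderingRel
  let B : g →ₗ[K] g →ₗ[K] g :=
    b.constr K fun i => b.constr K fun j => if i < j then ⁅b i, b j⁆ else 0
  refine ⟨B, fun x y => ?_⟩
  have key : B - B.flip = (LieModule.toEnd K g g : g →ₗ[K] Module.End K g) := by
    refine b.ext fun i => b.ext fun j => ?_
    rcases lt_trichotomy i j with hij | rfl | hij
    · simp [B, hij, hij.not_gt]
    · simp [B]
    · simp [B, hij, hij.not_gt]
  exact congrArg (fun F : g →ₗ[K] g →ₗ[K] g => F x y) key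

/-- The linear map `X ↦ A X ∘ φ`. -/
def actCochain (A : g →ₗ[K] Module.End K V) {n : ℕ} (φ : g [⋀^Fin n]→ₗ[K] V) :
    g →ₗ[K] g [⋀^Fin n]→ₗ[K] V where
  toFun X := (A X).compAlternatingMap φ
  map_add' X Y := by ext; simp
  map_smul' c X := by ext; simp

/-- For bilinear `B` on `g`, the map `X, Y ↦ φ(B(X, Y), …)`. -/
def insertBilin (B : g →ₗ[K] g →ₗ[K] g) {n : ℕ} (φ : g [⋀^Fin (n + 1)]→ₗ[K] V) :
    g →ₗ[K] g →ₗ[K] g [⋀^Fin n]→ₗ[K] V :=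
  B.compr₂ (AlternatingMap.curryLeft φ)

/-- `(X_0, …, X_{n+1}) ↦ φ([X_i, X_{j+1}], X_0, …, X̂_i, …, X̂_{j+1}, …, X_{n+1})` for `i ≤ j`. -/
def bracketTerm {n : ℕ} (φ : g [⋀^Fin (n + 1)]→ₗ[K] V) (i j : Fin (n + 1)) :
    MultilinearMap K (fun _ : Fin (n + 2) => g) V :=
  LinearMap.uncurryMid i.castSucc
    { toFun := fun X => LinearMap.uncurryMid j
        (AlternatingMap.toMultilinearMapLM (S := K) ∘ₗ
          insertBilin (LieModule.toEnd K g g : g →ₗ[K] Module.End K g) φ X)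
      map_add' := fun X Y => by ext; simp
      map_smul' := fun c X => by ext; simp }

theorem bracketTerm_apply {n : ℕ} (φ : g [⋀^Fin (n + 1)]→ₗ[K] V) (i j : Fin (n + 1))
    (v : Fin (n + 2) → g) :
    bracketTerm φ i j v =
      φ (Matrix.vecCons ⁅v i.castSucc, i.castSucc.removeNth v j⁆
        (j.removeNth (i.castSucc.removeNth v))) := rfl

theorem removeNth_castSucc_apply {W : Type*} {n : ℕ} (v : Fin (n + 2) → W) {i j : Fin (n + 1)} (hij : i ≤ j) :
    i.castSucc.removeNth v j = v j.succ := by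
  simp [Fin.removeNth_apply, Fin.succAbove_of_le_castSucc, hij]

theorem sum_bracketTerm_eq {n : ℕ} (φ : g [⋀^Fin (n + 1)]→ₗ[K] V) (B : g →ₗ[K] g →ₗ[K] g)
    (hB : ∀ x y, B x y - B y x = ⁅x, y⁆) (v : Fin (n + 2) → g) :
    (∑ i : Fin (n + 1), ∑ j ≥ i, (-1 : ℤ) ^ (i + j : ℕ) • bracketTerm φ i j) v =
      AlternatingMap.alternatizeUncurryFin
        (AlternatingMap.alternatizeUncurryFinLM ∘ₗ insertBilin B φ) v := by
  rw [AlternatingMap.alternatizeUncurryFin_alternatizeUncurryFinLM_comp_apply]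
  simp only [_root_.sum_apply, _root_.smul_apply]
  refine Finset.sum_congr rfl fun i _ => Finset.sum_congr rfl fun j hj => ?_
  rw [Finset.mem_Ici] at hj
  rw [bracketTerm_apply, removeNth_castSucc_apply v hj, ← hB]
  congr 1
  change AlternatingMap.curryLeft φ _ _ = AlternatingMap.curryLeft φ _ _ -
    AlternatingMap.curryLeft φ _ _
  rw [map_sub, AlternatingMap.sub_apply]

/-- The part of the Chevalley differential that involves the bracket of `g`:
`(dφ)(X_0, …, X_p) = ∑_{i < j} (-1)^(i+j) φ([X_i, X_j], X_0, …, X̂_i, …, X̂_j, …, X_p)`.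
A pair of indices `i ≤ j` in `Fin p` stands for the pair `i < j + 1` of indices of arguments.
In degree `0` the sum is empty. -/
def bracketD : (n : ℕ) → (g [⋀^Fin n]→ₗ[K] V) → g [⋀^Fin (n + 1)]→ₗ[K] V
  | 0, _ => 0
  | n + 1, φ =>
    { toMultilinearMap :=
        -∑ i : Fin (n + 1), ∑ j ≥ i, (-1 : ℤ) ^ (i + j : ℕ) • bracketTerm φ i j
      map_eq_zero_of_eq' := by
        intro v i j hv hij
        obtain ⟨B, hB⟩ := exists_bilin_sub_eq_lie K g
        change -((∑ i : Fin (n + 1), ∑ j ≥ i, (-1 : ℤ) ^ (i + j : ℕ) • bracketTerm φ i j) v) = 0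
        rw [sum_bracketTerm_eq φ B hB v, AlternatingMap.map_eq_zero_of_eq _ v hv hij, neg_zero] }

theorem bracketD_succ_apply {n : ℕ} (φ : g [⋀^Fin (n + 1)]→ₗ[K] V) (v : Fin (n + 2) → g) :
    bracketD (n + 1) φ v =
      ∑ i : Fin (n + 1), ∑ j ≥ i, (-1 : ℤ) ^ (i + j + 1 : ℕ) •
        φ (Matrix.vecCons ⁅v i.castSucc, v j.succ⁆ (j.removeNth (i.castSucc.removeNth v))) := by
  change -((∑ i : Fin (n + 1), ∑ j ≥ i, (-1 : ℤ) ^ (i + j : ℕ) • bracketTerm φ i j) v) = _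
  simp only [_root_.sum_apply, _root_.smul_apply, ← Finset.sum_neg_distrib]
  refine Finset.sum_congr rfl fun i _ => Finset.sum_congr rfl fun j hj => ?_
  rw [Finset.mem_Ici] at hj
  rw [bracketTerm_apply, removeNth_castSucc_apply v hj, pow_succ, mul_neg_one, neg_smul]

/-- The covariant exterior differential `δ_A : C^n(g; V) → C^{n+1}(g; V)` of a linear map
`A : g → End(V)`, where `C^n(g; V)` is the space of alternating `n`-linear maps:
`(δ_A φ)(X_0, …, X_n) = ∑_i (-1)^i A_{X_i} φ(X_0, …, X̂_i, …, X_n)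
  + ∑_{i < j} (-1)^(i+j) φ([X_i, X_j], X_0, …, X̂_i, …, X̂_j, …, X_n)`.
If `A` is a representation of `g`, this is the Chevalley differential. -/
def covD (A : g →ₗ[K] Module.End K V) (n : ℕ) :
    (g [⋀^Fin n]→ₗ[K] V) →ₗ[K] (g [⋀^Fin (n + 1)]→ₗ[K] V) where
  toFun φ := AlternatingMap.alternatizeUncurryFin (actCochain A φ) + bracketD n φ
  map_add' φ ψ := by
    ext v
    rcases n with _ | n
    · simp [actCochain, bracketD, AlternatingMap.alternatizeUncurryFin_apply,
        Finset.sum_add_distrib]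
    · simp only [AlternatingMap.add_apply, bracketD_succ_apply,
        AlternatingMap.alternatizeUncurryFin_apply, actCochain, LinearMap.coe_mk, AddHom.coe_mk,
        LinearMap.compAlternatingMap_apply, map_add, smul_add, Finset.sum_add_distrib]
      abel
  map_smul' c φ := by
    ext v
    rcases n with _ | n
    · simp [actCochain, bracketD, AlternatingMap.alternatizeUncurryFin_apply]
    · simp only [AlternatingMap.add_apply, AlternatingMap.smul_apply, bracketD_succ_apply,
        AlternatingMap.alternatizeUncurryFin_apply, actCochain, LinearMap.coe_mk, AddHom.coe_mk,
        LinearMap.compAlternatingMap_apply, map_smul, smul_add, Finset.smul_sum, RingHom.id_apply,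
        smul_comm c]

theorem covD_succ_apply (A : g →ₗ[K] Module.End K V) {n : ℕ} (φ : g [⋀^Fin (n + 1)]→ₗ[K] V)
    (v : Fin (n + 2) → g) :
    covD A (n + 1) φ v =
      ∑ i : Fin (n + 2), (-1 : ℤ) ^ (i : ℕ) • A (v i) (φ (i.removeNth v)) +
      ∑ i : Fin (n + 1), ∑ j ≥ i, (-1 : ℤ) ^ (i + j + 1 : ℕ) •
        φ (Matrix.vecCons ⁅v i.castSucc, v j.succ⁆ (j.removeNth (i.castSucc.removeNth v))) := by
  change (AlternatingMap.alternatizeUncurryFin (actCochain A φ) + bracketD (n + 1) φ) v = _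
  rw [AlternatingMap.add_apply, bracketD_succ_apply, AlternatingMap.alternatizeUncurryFin_apply]
  rfl

/-- The cocycles `Z^n(g; V)`. -/
def cocycles (A : g →ₗ[K] Module.End K V) (n : ℕ) : Submodule K (g [⋀^Fin n]→ₗ[K] V) :=
  LinearMap.ker (covD A n)

/-- The coboundaries `B^n(g; V)`. -/
def coboundaries (A : g →ₗ[K] Module.End K V) : (n : ℕ) → Submodule K (g [⋀^Fin n]→ₗ[K] V)
  | 0 => ⊥
  | n + 1 => LinearMap.range (covD A n)

/-- The Chevalley cohomology `H^n(g; V) = Z^n(g; V) / B^n(g; V)` of a representation `A` of `g`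
on `V`. Coboundaries of a representation are cocycles, so the quotient by the coboundaries that lie
in `Z^n(g; V)` is the quotient by `B^n(g; V)`. -/
abbrev Cohomology (A : g →ₗ[K] Module.End K V) (n : ℕ) : Type _ :=
  cocycles A n ⧸ (coboundaries A n).comap (cocycles A n).subtype

/-- The cohomology class of a cocycle. -/
def Cohomology.mk (A : g →ₗ[K] Module.End K V) (n : ℕ) : cocycles A n →ₗ[K] Cohomology A n :=
  Submodule.mkQ _

end Chevalley

/-! ## Lifts, their curvature, and the obstruction -/

section Lifts

variable {K : Type*} [Field K] {g h : Type*} [LieRing g] [LieAlgebra K g] [LieRing h]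
  [LieAlgebra K h]

/-- `α : g → der(h)` as a linear map to the endomorphisms of the vector space `h`. -/
def derEnd (α : g →ₗ[K] LieDerivation K h h) : g →ₗ[K] Module.End K h where
  toFun X := (α X).toLinearMap
  map_add' X Y := by ext; simp
  map_smul' c X := by ext; simp

/-- `α` is a linear lift of `ᾱ : g → out(h)`. -/
def IsLift (abar : g →ₗ⁅K⁆ Out K h) (α : g →ₗ[K] LieDerivation K h h) : Prop :=
  ∀ X, (LieSubmodule.Quotient.mk (α X) : Out K h) = abar X

/-- `[α_X, α_Y] - α_{[X,Y]} = ad_{ρ(X,Y)}` for all `X`, `Y`. -/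
def IsCurvature (α : g →ₗ[K] LieDerivation K h h) (ρ : g [⋀^Fin 2]→ₗ[K] h) : Prop :=
  ∀ X Y, ⁅α X, α Y⁆ - α ⁅X, Y⁆ = LieDerivation.ad K h (ρ ![X, Y])

/-- The cochain `λ(α, ρ) = δ_α ρ`. -/
def lam (α : g →ₗ[K] LieDerivation K h h) (ρ : g [⋀^Fin 2]→ₗ[K] h) : g [⋀^Fin 3]→ₗ[K] h :=
  covD (derEnd α) 2 ρ

/-- A cochain with values in `Z(h)` regarded as a cochain with values in `h`. -/
def centerIncl {n : ℕ} (μ : g [⋀^Fin n]→ₗ[K] LieAlgebra.center K h) : g [⋀^Fin n]→ₗ[K] h :=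
  (LieAlgebra.center K h).toSubmodule.subtype.compAlternatingMap μ

/-- `λ(α, ρ) = δ_α ρ` takes values in `Z(h)`, is a cocycle in `Z^3(g; Z(h))`, and `c` is its class
in `H^3(g; Z(h))`. -/
def IsClassOf (abar : g →ₗ⁅K⁆ Out K h) (α : g →ₗ[K] LieDerivation K h h)
    (ρ : g [⋀^Fin 2]→ₗ[K] h) (c : Cohomology (centerAction abar) 3) : Prop :=
  ∃ l : cocycles (centerAction abar) 3,
    centerIncl l.1 = lam α ρ ∧ Cohomology.mk (centerAction abar) 3 l = c

end Lifts

/-! ## Extensions -/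

section Extensions

universe u v

variable {K : Type*} [Field K] {g : Type u} {h : Type v} [LieRing g] [LieAlgebra K g] [LieRing h]
  [LieAlgebra K h]

theorem incl_toKer_symm (E : LieAlgebra.Extension K h g) (x : E.proj.ker) :
    E.incl (E.toKer.symm x) = x :=
  congrArg Subtype.val (E.toKer.apply_symm_apply x)

theorem exists_incl_eq (E : LieAlgebra.Extension K h g) {x : E.L} (hx : E.proj x = 0) :
    ∃ H, E.incl H = x :=
  ⟨E.toKer.symm ⟨x, LieHom.mem_ker.mpr hx⟩, incl_toKer_symm E _⟩

/-- For `0 → h → e → g → 0` and `x ∈ e`, the derivation `[x, ·]` of the ideal `h` of `e`. -/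
noncomputable def derOf (E : LieAlgebra.Extension K h g) (x : E.L) : LieDerivation K h h where
  toFun H := E.toKer.symm ⁅x, E.toKer H⁆
  map_add' H H' := by simp
  map_smul' c H := by simp
  leibniz' a b := by
    apply E.incl_injective
    have aux : ∀ H, E.incl (E.toKer.symm ⁅x, E.toKer H⁆) = ⁅x, E.incl H⁆ :=
      fun H => incl_toKer_symm E _
    change E.incl (E.toKer.symm ⁅x, E.toKer ⁅a, b⁆⁆) =
      E.incl (⁅a, E.toKer.symm ⁅x, E.toKer b⁆⁆ - ⁅b, E.toKer.symm ⁅x, E.toKer a⁆⁆)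
    rw [map_sub, LieHom.map_lie, LieHom.map_lie, aux, aux, aux, LieHom.map_lie, leibniz_lie,
      ← lie_skew (E.incl b)]
    abel

theorem incl_derOf (E : LieAlgebra.Extension K h g) (x : E.L) (H : h) :
    E.incl (derOf E x H) = ⁅x, E.incl H⁆ :=
  incl_toKer_symm E _

/-- The extension induces the homomorphism `ᾱ : g → out(h)`: an element `p(x)` of `g` is sent to
the class of the derivation `[x, ·]` of `h`. -/
def Induces (E : LieAlgebra.Extension K h g) (abar : g →ₗ⁅K⁆ Out K h) : Prop :=
  ∀ x : E.L, (LieSubmodule.Quotient.mk (derOf E x) : Out K h) = abar (E.proj x)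

/-- `(α, ρ)` is the datum of the extension for some linear section `s` of `p : e → g`:
`α_X = [s(X), ·]` and `ρ(X, Y) = [s(X), s(Y)] - s([X, Y])`. -/
def HasDatum (E : LieAlgebra.Extension K h g) (α : g →ₗ[K] LieDerivation K h h)
    (ρ : g [⋀^Fin 2]→ₗ[K] h) : Prop :=
  ∃ s : g →ₗ[K] E.L, (∀ X, E.proj (s X) = X) ∧ (∀ X, derOf E (s X) = α X) ∧
    ∀ X Y, E.incl (ρ ![X, Y]) = ⁅s X, s Y⁆ - s ⁅X, Y⁆

/-- Two extensions are equivalent: there is a Lie algebra homomorphism `φ : e → e'` that is the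
identity on `h` and on `g`. -/
def Equivalent (E E' : LieAlgebra.Extension K h g) : Prop :=
  ∃ φ : E.L →ₗ⁅K⁆ E'.L, (∀ H, φ (E.incl H) = E'.incl H) ∧ ∀ x, E'.proj (φ x) = E.proj x

theorem Equivalent.refl (E : LieAlgebra.Extension K h g) : Equivalent E E :=
  ⟨LieHom.id, fun _ => rfl, fun _ => rfl⟩

theorem Equivalent.trans {E E' E'' : LieAlgebra.Extension K h g} (h1 : Equivalent E E')
    (h2 : Equivalent E' E'') : Equivalent E E'' := by
  obtain ⟨φ, a, b⟩ := h1
  obtain ⟨ψ, c, d⟩ := h2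
  exact ⟨ψ.comp φ, fun H => by simp [a, c], fun x => by simp [b, d]⟩

theorem Equivalent.symm {E E' : LieAlgebra.Extension K h g} (h1 : Equivalent E E') :
    Equivalent E' E := by
  obtain ⟨φ, a, b⟩ := h1
  have hinj : Function.Injective φ := by
    intro x y hxy
    rw [← sub_eq_zero]
    have hp : E.proj (x - y) = 0 := by rw [← b, map_sub, hxy, sub_self, map_zero]
    obtain ⟨H, hH⟩ := exists_incl_eq E hp
    have h0 : E'.incl H = 0 := by rw [← a, hH, map_sub, hxy, sub_self]
    have : H = 0 := E'.incl_injective (by rw [h0, map_zero])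
    rw [← hH, this, map_zero]
  have hsurj : Function.Surjective φ := by
    intro y
    obtain ⟨x, hx⟩ := E.proj_surjective (E'.proj y)
    have hp : E'.proj (y - φ x) = 0 := by rw [map_sub, b, hx, sub_self]
    obtain ⟨H, hH⟩ := exists_incl_eq E' hp
    exact ⟨E.incl H + x, by rw [map_add, a, hH]; abel⟩
  let e : E.L ≃ₗ⁅K⁆ E'.L := LieEquiv.ofBijective φ ⟨hinj, hsurj⟩
  have he : ∀ x, e x = φ x := fun _ => rfl
  refine ⟨(e.symm : E'.L →ₗ⁅K⁆ E.L), fun H => ?_, fun y => ?_⟩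
  · apply hinj
    rw [a]
    exact e.apply_symm_apply (E'.incl H)
  · rw [← b]
    exact congrArg E'.proj (e.apply_symm_apply y)

/-- Extensions `0 → h → e → g → 0` that induce `ᾱ`. The vector space `e` is isomorphic to `h × g`,
so nothing is lost by taking it in the universe of `h × g`. -/
def InducingExtension (abar : g →ₗ⁅K⁆ Out K h) : Type _ :=
  {E : LieAlgebra.Extension.{_, _, _, max u v} K h g // Induces E abar}

/-- Equivalence of extensions that induce `ᾱ`. -/
instance inducingSetoid (abar : g →ₗ⁅K⁆ Out K h) : Setoid (InducingExtension abar) where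
  r E E' := Equivalent E.1 E'.1
  iseqv := ⟨fun E => Equivalent.refl E.1, Equivalent.symm, Equivalent.trans⟩

end Extensions

end LieExt

namespace LieExt

/-! ### The differential in degrees one to three on explicit arguments -/

section Formulas

variable {K : Type*} [Field K] {g V : Type*} [LieRing g] [LieAlgebra K g] [AddCommGroup V]
  [Module K V]

/-! A linear section `s` of an extension turns it into a datum: `α_X = [s(X), ·]`, and `ρ` measures
the failure of `s` to be a homomorphism. The Jacobi identity of the extension amounts to the
curvature equation for `(α, ρ)` together with `δ_α ρ = 0`. Conversely, such a pair defines a Lie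
bracket on `h × g` (`twisted_jacobi`), and extensions with a common datum are equivalent
(`HasDatum.equivalent`).

Since `ᾱ` is a homomorphism, the curvature of a lift `α` is inner, hence of the form `ad_ρ`, with
`ρ` unique up to central two-forms. Jacobi for derivations gives `ad_λ = 0` for `λ = δ_α ρ`
(`lam_mem_center`), and `δ_α λ` reduces to commutators of values of `ρ`, which cancel in pairs
(`covD_lam`). Replacing `α` by `α + ad_b` and shifting `ρ` accordingly leaves `λ` unchanged
(`lam_shift`); adding a central `μ` to `ρ` changes `λ` by `δμ` (`lam_add_centerIncl`). So the class
of `λ` depends only on `ᾱ`, and it vanishes exactly when `ρ` can be corrected to make `λ = 0`, that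
is, when an extension exists.

For the classification, fix `(α, ρ)` with `λ = 0`. Every extension inducing `ᾱ` has a section that
realizes `α`, and its two-form is `ρ - μ` for a central cocycle `μ`. Sections realizing the same `α`
differ by a central linear map `b`, which changes the two-form by `δb`. Hence the classes correspond
to cocycles modulo coboundaries. -/

theorem covD_one_apply (A : g →ₗ[K] Module.End K V) (φ : g [⋀^Fin 1]→ₗ[K] V) (X Y : g) :
    covD A 1 φ ![X, Y] = A X (φ ![Y]) - A Y (φ ![X]) - φ ![⁅X, Y⁆] := by
  rw [covD_succ_apply]
  have h0 : Finset.Ici (0 : Fin 1) = {0} := by decide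
  have e0 : (0 : Fin 2).removeNth ![X, Y] = ![Y] := by ext i; fin_cases i; rfl
  have e1 : (1 : Fin 2).removeNth ![X, Y] = ![X] := by ext i; fin_cases i; rfl
  have f0 : (0 : Fin 1).removeNth ![Y] = ![] := Subsingleton.elim _ _
  simp [Fin.sum_univ_succ, h0, e0, e1, f0]
  abel

theorem covD_two_apply (A : g →ₗ[K] Module.End K V) (φ : g [⋀^Fin 2]→ₗ[K] V) (X Y Z : g) :
    covD A 2 φ ![X, Y, Z] =
      A X (φ ![Y, Z]) - A Y (φ ![X, Z]) + A Z (φ ![X, Y]) -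
        φ ![⁅X, Y⁆, Z] + φ ![⁅X, Z⁆, Y] - φ ![⁅Y, Z⁆, X] := by
  rw [covD_succ_apply]
  have h0 : Finset.Ici (0 : Fin 2) = {0, 1} := by decide
  have h1 : Finset.Ici (1 : Fin 2) = {1} := by decide
  have e0 : (0 : Fin 3).removeNth ![X, Y, Z] = ![Y, Z] := by ext i; fin_cases i <;> rfl
  have e1 : (1 : Fin 3).removeNth ![X, Y, Z] = ![X, Z] := by ext i; fin_cases i <;> rfl
  have e2 : (2 : Fin 3).removeNth ![X, Y, Z] = ![X, Y] := by ext i; fin_cases i <;> rfl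
  have f0 (A B : g) : (0 : Fin 2).removeNth ![A, B] = ![B] := by ext i; fin_cases i; rfl
  have f1 (A B : g) : (1 : Fin 2).removeNth ![A, B] = ![A] := by ext i; fin_cases i; rfl
  simp [Fin.sum_univ_succ, h0, h1, e0, e1, e2, f0, f1]
  abel

theorem covD_three_apply (A : g →ₗ[K] Module.End K V) (φ : g [⋀^Fin 3]→ₗ[K] V) (X Y Z W : g) :
    covD A 3 φ ![X, Y, Z, W] =
      A X (φ ![Y, Z, W]) - A Y (φ ![X, Z, W]) + A Z (φ ![X, Y, W]) - A W (φ ![X, Y, Z]) -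
        φ ![⁅X, Y⁆, Z, W] + φ ![⁅X, Z⁆, Y, W] - φ ![⁅X, W⁆, Y, Z] - φ ![⁅Y, Z⁆, X, W] +
        φ ![⁅Y, W⁆, X, Z] - φ ![⁅Z, W⁆, X, Y] := by
  rw [covD_succ_apply]
  have h0 : Finset.Ici (0 : Fin 3) = {0, 1, 2} := by decide
  have h1 : Finset.Ici (1 : Fin 3) = {1, 2} := by decide
  have h2 : Finset.Ici (2 : Fin 3) = {2} := by decide
  have e0 : (0 : Fin 4).removeNth ![X, Y, Z, W] = ![Y, Z, W] := by ext i; fin_cases i <;> rfl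
  have e1 : (1 : Fin 4).removeNth ![X, Y, Z, W] = ![X, Z, W] := by ext i; fin_cases i <;> rfl
  have e2 : (2 : Fin 4).removeNth ![X, Y, Z, W] = ![X, Y, W] := by ext i; fin_cases i <;> rfl
  have e3 : (3 : Fin 4).removeNth ![X, Y, Z, W] = ![X, Y, Z] := by ext i; fin_cases i <;> rfl
  have f0 (A B C : g) : (0 : Fin 3).removeNth ![A, B, C] = ![B, C] := by
    ext i; fin_cases i <;> rfl
  have f1 (A B C : g) : (1 : Fin 3).removeNth ![A, B, C] = ![A, C] := by
    ext i; fin_cases i <;> rfl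
  have f2 (A B C : g) : (2 : Fin 3).removeNth ![A, B, C] = ![A, B] := by
    ext i; fin_cases i <;> rfl
  have s2 : Fin.succ (2 : Fin 3) = 3 := rfl
  simp [Fin.sum_univ_succ, h0, h1, h2, e0, e1, e2, e3, f0, f1, f2, s2]
  abel

end Formulas

/-! ### Alternating forms of low degree -/

section TwoForms

variable {K : Type*} [Field K] {g V : Type*} [AddCommGroup g] [Module K g] [AddCommGroup V]
  [Module K V]

/-- The alternating map of an alternating bilinear map. -/
def altOfBilin (B : g →ₗ[K] g →ₗ[K] V) (hB : ∀ x, B x x = 0) : g [⋀^Fin 2]→ₗ[K] V where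
  toFun v := B (v 0) (v 1)
  map_update_add' v i x y := by fin_cases i <;> simp [Function.update]
  map_update_smul' v i c x := by fin_cases i <;> simp [Function.update]
  map_eq_zero_of_eq' v i j hv hij := by
    have h01 : v 0 = v 1 := by
      fin_cases i <;> fin_cases j <;> simp_all
    rw [h01, hB]

@[simp] theorem altOfBilin_apply (B : g →ₗ[K] g →ₗ[K] V) (hB : ∀ x, B x x = 0) (x y : g) :
    altOfBilin B hB ![x, y] = B x y := rfl

/-- The alternating map in one variable of a linear map. -/
def altOfLinear (b : g →ₗ[K] V) : g [⋀^Fin 1]→ₗ[K] V where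
  toFun v := b (v 0)
  map_update_add' v i x y := by fin_cases i; simp [Function.update]
  map_update_smul' v i c x := by fin_cases i; simp [Function.update]
  map_eq_zero_of_eq' v i j hv hij := (hij (Subsingleton.elim _ _)).elim

theorem exists_altOfLinear_eq (φ : g [⋀^Fin 1]→ₗ[K] V) : ∃ b : g →ₗ[K] V, altOfLinear b = φ := by
  -- Currying leaves a form in no variables, which is an element of `V`.
  refine ⟨AlternatingMap.constLinearEquivOfIsEmpty.symm.toLinearMap ∘ₗ φ.curryLeft, ?_⟩
  ext v
  change φ _ = _
  congr 1
  ext i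
  fin_cases i
  rfl

theorem two_swap (φ : g [⋀^Fin 2]→ₗ[K] V) (x y : g) : φ ![y, x] = -φ ![x, y] := by
  rw [← φ.map_swap _ (i := 0) (j := 1) (by decide)]
  congr 1
  ext i
  fin_cases i <;> rfl

theorem two_ext {φ ψ : g [⋀^Fin 2]→ₗ[K] V} (H : ∀ x y, φ ![x, y] = ψ ![x, y]) : φ = ψ := by
  apply AlternatingMap.ext
  intro v
  have : v = ![v 0, v 1] := by ext i; fin_cases i <;> rfl
  rw [this, H]

theorem three_ext {φ ψ : g [⋀^Fin 3]→ₗ[K] V}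
    (H : ∀ x y z, φ ![x, y, z] = ψ ![x, y, z]) : φ = ψ := by
  apply AlternatingMap.ext
  intro v
  have : v = ![v 0, v 1, v 2] := by ext i; fin_cases i <;> rfl
  rw [this, H]

theorem four_ext {φ ψ : g [⋀^Fin 4]→ₗ[K] V}
    (H : ∀ x y z w, φ ![x, y, z, w] = ψ ![x, y, z, w]) : φ = ψ := by
  apply AlternatingMap.ext
  intro v
  have : v = ![v 0, v 1, v 2, v 3] := by ext i; fin_cases i <;> rfl
  rw [this, H]

theorem two_add_left (φ : g [⋀^Fin 2]→ₗ[K] V) (x x' y : g) :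
    φ ![x + x', y] = φ ![x, y] + φ ![x', y] :=
  φ.toMultilinearMap.cons_add ![y] x x'

theorem two_smul_left (φ : g [⋀^Fin 2]→ₗ[K] V) (c : K) (x y : g) :
    φ ![c • x, y] = c • φ ![x, y] :=
  φ.toMultilinearMap.cons_smul ![y] c x

theorem two_neg_left (φ : g [⋀^Fin 2]→ₗ[K] V) (x y : g) : φ ![-x, y] = -φ ![x, y] := by
  rw [← neg_one_smul K, two_smul_left, neg_one_smul]

theorem two_sub_left (φ : g [⋀^Fin 2]→ₗ[K] V) (x x' y : g) :
    φ ![x - x', y] = φ ![x, y] - φ ![x', y] := by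
  rw [sub_eq_add_neg, two_add_left, two_neg_left, sub_eq_add_neg]

theorem two_add_right (φ : g [⋀^Fin 2]→ₗ[K] V) (x y y' : g) :
    φ ![x, y + y'] = φ ![x, y] + φ ![x, y'] := by
  rw [two_swap, two_add_left, two_swap φ x y, two_swap φ x y', neg_add, neg_neg, neg_neg]

theorem two_smul_right (φ : g [⋀^Fin 2]→ₗ[K] V) (c : K) (x y : g) :
    φ ![x, c • y] = c • φ ![x, y] := by
  rw [two_swap, two_smul_left, two_swap φ x y, smul_neg, neg_neg]

theorem two_zero_right (φ : g [⋀^Fin 2]→ₗ[K] V) (x : g) : φ ![x, 0] = 0 :=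
  φ.map_coord_zero 1 rfl

theorem two_self (φ : g [⋀^Fin 2]→ₗ[K] V) (x : g) : φ ![x, x] = 0 :=
  φ.map_eq_zero_of_eq _ (i := 0) (j := 1) rfl (by decide)

end TwoForms

end LieExt

namespace LieExt

/-! ### The obstruction class in degree three -/

section Obstruction

variable {K : Type*} [Field K] {g h : Type*} [LieRing g] [LieAlgebra K g] [LieRing h]
  [LieAlgebra K h]

/-- Jacobi with every double bracket nested on the left, the shape in which brackets enter the first
slot of a form. It eliminates one of the three double brackets, after which `abel` can finish. -/
theorem lie_lie_eq_sub (X Y Z : g) : ⁅⁅X, Y⁆, Z⁆ = ⁅⁅X, Z⁆, Y⁆ - ⁅⁅Y, Z⁆, X⁆ := by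
  rw [lie_lie X Y Z, ← lie_skew ⁅X, Z⁆ Y, ← lie_skew ⁅Y, Z⁆ X]
  abel

theorem mem_center_iff {z : h} : z ∈ LieAlgebra.center K h ↔ ∀ x : h, ⁅x, z⁆ = 0 :=
  LieModule.mem_maxTrivSubmodule (R := K) (L := h) (M := h) z

theorem lie_center (z : LieAlgebra.center K h) (x : h) : ⁅x, (z : h)⁆ = 0 :=
  mem_center_iff.mp z.2 x

theorem center_lie (z : LieAlgebra.center K h) (x : h) : ⁅(z : h), x⁆ = 0 := by
  rw [← lie_skew, lie_center, neg_zero]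

theorem ad_apply_eq_lie (x y : h) : LieDerivation.ad K h x y = ⁅x, y⁆ := by
  simp

theorem ad_center (z : LieAlgebra.center K h) : LieDerivation.ad K h (z : h) = 0 := by
  ext x
  simp [center_lie]

@[simp] theorem derEnd_apply (α : g →ₗ[K] LieDerivation K h h) (X : g) (H : h) :
    derEnd α X H = α X H := rfl

@[simp] theorem centerIncl_apply {n : ℕ} (μ : g [⋀^Fin n]→ₗ[K] LieAlgebra.center K h)
    (v : Fin n → g) : centerIncl μ v = (μ v : h) := rfl

theorem centerIncl_injective {n : ℕ} :
    Function.Injective (centerIncl : (g [⋀^Fin n]→ₗ[K] LieAlgebra.center K h) → _) := by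
  intro μ ν hμ
  ext v
  exact congrArg (fun φ : g [⋀^Fin n]→ₗ[K] h => φ v) hμ

theorem centerIncl_add {n : ℕ} (μ ν : g [⋀^Fin n]→ₗ[K] LieAlgebra.center K h) :
    centerIncl (μ + ν) = centerIncl μ + centerIncl ν := by
  ext; simp

theorem centerIncl_sub {n : ℕ} (μ ν : g [⋀^Fin n]→ₗ[K] LieAlgebra.center K h) :
    centerIncl (μ - ν) = centerIncl μ - centerIncl ν := by
  ext; simp

theorem centerIncl_zero {n : ℕ} :
    centerIncl (0 : g [⋀^Fin n]→ₗ[K] LieAlgebra.center K h) = 0 := by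
  ext; simp

theorem exists_centerIncl_eq {n : ℕ} {φ : g [⋀^Fin n]→ₗ[K] h}
    (hφ : ∀ v, φ v ∈ LieAlgebra.center K h) :
    ∃ μ : g [⋀^Fin n]→ₗ[K] LieAlgebra.center K h, centerIncl μ = φ :=
  ⟨φ.codRestrict (LieAlgebra.center K h).toSubmodule hφ, by ext; rfl⟩

variable {abar : g →ₗ⁅K⁆ Out K h} {α α' : g →ₗ[K] LieDerivation K h h}
  {ρ ρ' : g [⋀^Fin 2]→ₗ[K] h}

theorem coe_centerAction (hα : IsLift abar α) (X : g) (z : LieAlgebra.center K h) :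
    (centerAction abar X z : h) = α X z := by
  change (outCenter K h (abar X) z : h) = _
  rw [← hα X]
  rfl

/-- Every lift acts on `Z(h)` as `ᾱ` does. Computations with central cochains can therefore take
place in `h`, with an `α` that need not be a representation. -/
theorem centerIncl_covD (hα : IsLift abar α) {n : ℕ}
    (μ : g [⋀^Fin (n + 1)]→ₗ[K] LieAlgebra.center K h) :
    centerIncl (covD (centerAction abar) (n + 1) μ) =
      covD (derEnd α) (n + 1) (centerIncl μ) := by
  ext v
  rw [centerIncl_apply, covD_succ_apply, covD_succ_apply]
  simp [coe_centerAction hα]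

theorem lam_apply (α : g →ₗ[K] LieDerivation K h h) (ρ : g [⋀^Fin 2]→ₗ[K] h) (X Y Z : g) :
    lam α ρ ![X, Y, Z] =
      α X (ρ ![Y, Z]) - α Y (ρ ![X, Z]) + α Z (ρ ![X, Y]) -
        ρ ![⁅X, Y⁆, Z] + ρ ![⁅X, Z⁆, Y] - ρ ![⁅Y, Z⁆, X] :=
  covD_two_apply _ _ _ _ _

/-- Oriented as a rewrite rule that exchanges `α_X` and `α_Y`, so that iterated derivations reach a
normal form. -/
theorem isCurvature_iff : IsCurvature α ρ ↔
    ∀ X Y H, α X (α Y H) = α Y (α X H) + α ⁅X, Y⁆ H + ⁅ρ ![X, Y], H⁆ := by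
  refine forall₂_congr fun X Y => ?_
  rw [LieDerivation.ext_iff]
  refine forall_congr' fun H => ?_
  simp only [LieDerivation.sub_apply, LieDerivation.lie_apply, ad_apply_eq_lie]
  constructor
  · intro e
    rw [← e]
    abel
  · intro e
    rw [e]
    abel

/-- The Bianchi identity: as `[D, ad_x] = ad_{D x}`, the cyclic sum defining `ad_λ` consists of the
Jacobi sums in `der(h)` and in `g`, and mixed terms `[α_X, α_{[Y,Z]}]` that cancel. -/
theorem lam_mem_center (hρ : IsCurvature α ρ) (v : Fin 3 → g) :
    lam α ρ v ∈ LieAlgebra.center K h := by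
  rw [isCurvature_iff] at hρ
  have hv : v = ![v 0, v 1, v 2] := by ext i; fin_cases i <;> rfl
  rw [hv, mem_center_iff, lam_apply]
  generalize v 0 = X
  generalize v 1 = Y
  generalize v 2 = Z
  intro H
  have hb (X Y : g) (H : h) : ⁅H, ρ ![X, Y]⁆ = α Y (α X H) - α X (α Y H) + α ⁅X, Y⁆ H := by
    rw [hρ X Y, ← lie_skew H]
    abel
  have hd (X : g) (H H' : h) : ⁅H, α X H'⁆ = α X ⁅H, H'⁆ - ⁅α X H, H'⁆ := by
    rw [LieDerivation.apply_lie_eq_add]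
    abel
  simp only [lie_add, lie_sub, hd, hb, map_add, map_sub]
  rw [lie_lie_eq_sub X Y Z, map_sub, LieDerivation.sub_apply]
  abel

/-- Applying `δ_α` twice leaves only the curvature acting on `ρ`, that is, terms `[ρ(X,Y), ρ(Z,W)]`.
Each occurs together with its reverse and cancels by skew-symmetry; the terms in double brackets of
`g` cancel by Jacobi. -/
theorem covD_lam (hρ : IsCurvature α ρ) : covD (derEnd α) 3 (lam α ρ) = 0 := by
  rw [isCurvature_iff] at hρ
  refine four_ext fun X Y Z W => ?_
  rw [covD_three_apply]
  simp only [lam_apply, derEnd_apply, map_add, map_sub]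
  rw [hρ X Y, hρ X Z, hρ X W, hρ Y Z, hρ Y W, hρ Z W,
    ← lie_skew (ρ ![Z, W]) (ρ ![X, Y]), ← lie_skew (ρ ![Y, W]) (ρ ![X, Z]),
    ← lie_skew (ρ ![Y, Z]) (ρ ![X, W]), two_swap ρ ⁅X, Y⁆ ⁅Z, W⁆, two_swap ρ ⁅X, Z⁆ ⁅Y, W⁆,
    two_swap ρ ⁅X, W⁆ ⁅Y, Z⁆, lie_lie_eq_sub X Y Z, lie_lie_eq_sub X Y W, lie_lie_eq_sub X Z W,
    lie_lie_eq_sub Y Z W]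
  simp only [two_sub_left, AlternatingMap.zero_apply]
  abel

/-- The linear map `X ↦ α_X + ad_{b(X)}`. -/
def shiftLift (α : g →ₗ[K] LieDerivation K h h) (b : g →ₗ[K] h) :
    g →ₗ[K] LieDerivation K h h :=
  α + (LieDerivation.ad K h : h →ₗ[K] LieDerivation K h h) ∘ₗ b

@[simp] theorem shiftLift_apply (α : g →ₗ[K] LieDerivation K h h) (b : g →ₗ[K] h) (X : g) :
    shiftLift α b X = α X + LieDerivation.ad K h (b X) := rfl

theorem shiftLift_apply_apply (α : g →ₗ[K] LieDerivation K h h) (b : g →ₗ[K] h) (X : g) (H : h) :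
    shiftLift α b X H = α X H + ⁅b X, H⁆ := by
  simp

/-- The alternating map `ρ + δ_α b + [b, b] / 2`, where `([b, b] / 2)(X, Y) = [b(X), b(Y)]`. -/
def shiftForm (α : g →ₗ[K] LieDerivation K h h) (ρ : g [⋀^Fin 2]→ₗ[K] h) (b : g →ₗ[K] h) :
    g [⋀^Fin 2]→ₗ[K] h :=
  ρ + covD (derEnd α) 1 (altOfLinear b) +
    altOfBilin ((LieModule.toEnd K h h : h →ₗ[K] Module.End K h).compl₁₂ b b)
      fun x => lie_self (b x)

theorem shiftForm_apply (α : g →ₗ[K] LieDerivation K h h) (ρ : g [⋀^Fin 2]→ₗ[K] h)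
    (b : g →ₗ[K] h) (X Y : g) :
    shiftForm α ρ b ![X, Y] =
      ρ ![X, Y] + (α X (b Y) - α Y (b X) - b ⁅X, Y⁆) + ⁅b X, b Y⁆ := by
  rw [shiftForm, AlternatingMap.add_apply, AlternatingMap.add_apply, covD_one_apply]
  rfl

/-- The cross terms come from `[D, ad_x] = ad_{D x}`, and the quadratic one from `[ad_x, ad_y] =
ad_{[x,y]}`. -/
theorem IsCurvature.shift (hρ : IsCurvature α ρ) (b : g →ₗ[K] h) :
    IsCurvature (shiftLift α b) (shiftForm α ρ b) := by
  rw [isCurvature_iff] at hρ ⊢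
  intro X Y H
  simp only [shiftLift_apply_apply, shiftForm_apply, map_add, LieDerivation.apply_lie_eq_add,
    lie_add, add_lie, sub_lie, hρ X Y, lie_lie (b _) (b _) H]
  abel

/-- Equality holds for the cochains, not just for their classes. The term `δ_α δ_α b` is the action
of `ρ` on `b` and cancels `ad_b` applied to `ρ`; `δ_α` of the quadratic term cancels `ad_b` applied
to `δ_α b`; the cubic terms vanish by Jacobi. -/
theorem lam_shift (hρ : IsCurvature α ρ) (b : g →ₗ[K] h) :
    lam (shiftLift α b) (shiftForm α ρ b) = lam α ρ := by
  rw [isCurvature_iff] at hρ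
  refine three_ext fun X Y Z => ?_
  simp only [lam_apply, shiftLift_apply_apply, shiftForm_apply, map_add, map_sub,
    LieDerivation.apply_lie_eq_add, lie_add, add_lie, lie_lie (b _) (b _) (b _)]
  have sk (x y : g) : ⁅b y, b x⁆ = -⁅b x, b y⁆ := (lie_skew _ _).symm
  have hJ : ⁅b Z, ⁅b X, b Y⁆⁆ = ⁅b Y, ⁅b X, b Z⁆⁆ - ⁅b X, ⁅b Y, b Z⁆⁆ := by
    rw [← lie_skew (b Z), lie_lie]
    abel
  -- Each bracket is given one fixed orientation, so that the cancellation becomes additive.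
  rw [hρ X Y, hρ X Z, hρ Y Z, lie_lie_eq_sub X Y Z, map_sub, sk Y Z, lie_neg, hJ, ← lie_skew (b Z) (ρ ![X, Y]), ← lie_skew (b Y) (ρ ![X, Z]),
    ← lie_skew (b X) (ρ ![Y, Z]), ← lie_skew (b Z) (α X (b Y)), ← lie_skew (b Z) (α Y (b X)),
    ← lie_skew (b Y) (α X (b Z)), ← lie_skew (b Y) (α Z (b X)), ← lie_skew (b X) (α Y (b Z)),
    ← lie_skew (b X) (α Z (b Y)), ← lie_skew (b Z) (b ⁅X, Y⁆), ← lie_skew (b Y) (b ⁅X, Z⁆),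
    ← lie_skew (b X) (b ⁅Y, Z⁆)]
  abel

variable (K h) in
/-- The adjoint representation has a linear section over the inner derivations. -/
theorem exists_section_ad : ∃ t : LieDerivation K h h →ₗ[K] h,
    ∀ D, (LieSubmodule.Quotient.mk D : Out K h) = 0 → LieDerivation.ad K h (t D) = D := by
  obtain ⟨s, hs⟩ := LinearMap.exists_rightInverse_of_surjective
    (LieDerivation.ad K h : h →ₗ[K] LieDerivation K h h).rangeRestrict
    (LinearMap.range_rangeRestrict _)
  -- `s` lives on the inner derivations only; extended to all of `der(h)`, it can be composed with
  -- any linear map into `der(h)`.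
  obtain ⟨t, ht⟩ := LinearMap.exists_extend s
  refine ⟨t, fun D hD => ?_⟩
  obtain ⟨x, rfl⟩ := LieDerivation.mem_ad_idealRange_iff.mp
    ((LieSubmodule.Quotient.mk_eq_zero' (N := (LieDerivation.ad K h).idealRange)).mp hD)
  let y : LinearMap.range (LieDerivation.ad K h : h →ₗ[K] LieDerivation K h h) :=
    ⟨LieDerivation.ad K h x, x, rfl⟩
  have h1 : t (LieDerivation.ad K h x) = s y := LinearMap.congr_fun ht y
  rw [h1]
  exact congrArg Subtype.val (LinearMap.congr_fun hs y)

theorem exists_isLift (abar : g →ₗ⁅K⁆ Out K h) : ∃ α, IsLift abar α := by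
  obtain ⟨s, hs⟩ := LinearMap.exists_rightInverse_of_surjective
    ((LieDerivation.ad K h).idealRange.toSubmodule.mkQ)
    (LinearMap.range_eq_top.mpr (Submodule.mkQ_surjective _))
  exact ⟨s ∘ₗ (abar : g →ₗ[K] Out K h), fun X => LinearMap.congr_fun hs (abar X)⟩

theorem IsLift.exists_shift (hα : IsLift abar α) (hα' : IsLift abar α') :
    ∃ b : g →ₗ[K] h, shiftLift α b = α' := by
  obtain ⟨t, ht⟩ := exists_section_ad K h
  refine ⟨t ∘ₗ (α' - α), LinearMap.ext fun X => ?_⟩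
  have h1 : (LieSubmodule.Quotient.mk ((α' - α) X) : Out K h) =
      LieSubmodule.Quotient.mk (α' X) - LieSubmodule.Quotient.mk (α X) := rfl
  rw [shiftLift_apply, LinearMap.comp_apply, ht _ (by rw [h1, hα, hα', sub_self])]
  simp

/-- The curvature of `α` dies in `out(h)` because `ᾱ` is a homomorphism. Applying a linear section
of `ad` to it keeps it bilinear and alternating. -/
theorem IsLift.exists_isCurvature (hα : IsLift abar α) : ∃ ρ, IsCurvature α ρ := by
  have hF (X Y : g) : (LieSubmodule.Quotient.mk (⁅α X, α Y⁆ - α ⁅X, Y⁆) : Out K h) = 0 := by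
    have h1 : (LieSubmodule.Quotient.mk (⁅α X, α Y⁆ - α ⁅X, Y⁆) : Out K h) =
      ⁅(LieSubmodule.Quotient.mk (α X) : Out K h), LieSubmodule.Quotient.mk (α Y)⁆ -
        LieSubmodule.Quotient.mk (α ⁅X, Y⁆) := rfl
    rw [h1, hα, hα, hα, LieHom.map_lie, sub_self]
  obtain ⟨t, ht⟩ := exists_section_ad K h
  let B : g →ₗ[K] g →ₗ[K] LieDerivation K h h :=
    (LieModule.toEnd K (LieDerivation K h h) (LieDerivation K h h) :
      LieDerivation K h h →ₗ[K] Module.End K (LieDerivation K h h)).compl₁₂ α α -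
    (LieModule.toEnd K g g : g →ₗ[K] Module.End K g).compr₂ α
  have hB (X Y : g) : B X Y = ⁅α X, α Y⁆ - α ⁅X, Y⁆ := rfl
  refine ⟨altOfBilin (B.compr₂ t) fun X => ?_, fun X Y => ?_⟩
  · rw [LinearMap.compr₂_apply, hB, lie_self, lie_self, map_zero, sub_zero, map_zero]
  · rw [altOfBilin_apply, LinearMap.compr₂_apply, hB, ht _ (hF X Y)]

/-- The maps `ρ` that go with a lift `α` form a torsor under the central two-forms. -/
theorem IsCurvature.exists_eq_add (hρ : IsCurvature α ρ) (hρ' : IsCurvature α ρ') :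
    ∃ μ : g [⋀^Fin 2]→ₗ[K] LieAlgebra.center K h, ρ' = ρ + centerIncl μ := by
  obtain ⟨μ, hμ⟩ := exists_centerIncl_eq (φ := ρ' - ρ) fun v => by
    have hv : v = ![v 0, v 1] := by ext i; fin_cases i <;> rfl
    rw [hv, mem_center_iff]
    intro x
    have h1 : LieDerivation.ad K h (ρ ![v 0, v 1]) x = LieDerivation.ad K h (ρ' ![v 0, v 1]) x := by
      rw [← hρ, ← hρ']
    rw [ad_apply_eq_lie, ad_apply_eq_lie] at h1
    rw [AlternatingMap.sub_apply, ← lie_skew, sub_lie, h1, sub_self, neg_zero]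
  exact ⟨μ, by rw [hμ, add_sub_cancel]⟩

theorem IsCurvature.add_centerIncl (hρ : IsCurvature α ρ)
    (μ : g [⋀^Fin 2]→ₗ[K] LieAlgebra.center K h) : IsCurvature α (ρ + centerIncl μ) := by
  intro X Y
  rw [hρ, AlternatingMap.add_apply, map_add, centerIncl_apply, ad_center, add_zero]

theorem lam_add_centerIncl (hα : IsLift abar α) (ρ : g [⋀^Fin 2]→ₗ[K] h)
    (μ : g [⋀^Fin 2]→ₗ[K] LieAlgebra.center K h) :
    lam α (ρ + centerIncl μ) = lam α ρ + centerIncl (covD (centerAction abar) 2 μ) := by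
  rw [centerIncl_covD hα]
  exact map_add _ _ _

theorem exists_isClassOf (hα : IsLift abar α) (hρ : IsCurvature α ρ) :
    ∃ c, IsClassOf abar α ρ c := by
  obtain ⟨l, hl⟩ := exists_centerIncl_eq (lam_mem_center hρ)
  refine ⟨_, ⟨l, ?_⟩, hl, rfl⟩
  rw [cocycles, LinearMap.mem_ker]
  apply centerIncl_injective
  rw [centerIncl_covD hα, hl, covD_lam hρ, centerIncl_zero]

theorem IsClassOf.unique {c c' : Cohomology (centerAction abar) 3} (hc : IsClassOf abar α ρ c)
    (hc' : IsClassOf abar α ρ c') : c = c' := by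
  obtain ⟨l, hl, rfl⟩ := hc
  obtain ⟨l', hl', rfl⟩ := hc'
  rw [Subtype.ext (centerIncl_injective (hl.trans hl'.symm))]

theorem Cohomology.mk_eq_mk_iff {V : Type*} [AddCommGroup V] [Module K V]
    {A : g →ₗ[K] Module.End K V} {n : ℕ} {μ ν : cocycles A (n + 1)} :
    Cohomology.mk A (n + 1) μ = Cohomology.mk A (n + 1) ν ↔ ∃ φ, covD A n φ = μ.1 - ν.1 :=
  Submodule.Quotient.eq _

/-- Any two admissible pairs are joined by a shift, which fixes `λ`, followed by a central change of
`ρ`, which adds a coboundary to `λ`. -/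
theorem IsClassOf.of_admissible (hα : IsLift abar α) (hρ : IsCurvature α ρ)
    (hα' : IsLift abar α') (hρ' : IsCurvature α' ρ') {c : Cohomology (centerAction abar) 3}
    (hc : IsClassOf abar α ρ c) : IsClassOf abar α' ρ' c := by
  obtain ⟨c', hc'⟩ := exists_isClassOf hα' hρ'
  obtain ⟨b, rfl⟩ := hα.exists_shift hα'
  obtain ⟨μ, rfl⟩ := (hρ.shift b).exists_eq_add hρ'
  suffices c' = c from this ▸ hc'
  obtain ⟨l, hl, rfl⟩ := hc
  obtain ⟨l', hl', rfl⟩ := hc'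
  rw [lam_add_centerIncl hα', lam_shift hρ, ← hl, ← centerIncl_add] at hl'
  rw [Cohomology.mk_eq_mk_iff]
  exact ⟨μ, by rw [centerIncl_injective hl', add_sub_cancel_left]⟩

/-- A primitive of `λ` is subtracted from `ρ`; the lift itself stays the same. -/
theorem IsClassOf.exists_lam_eq_zero (hα : IsLift abar α) (hρ : IsCurvature α ρ)
    (hc : IsClassOf abar α ρ 0) : ∃ ρ', IsCurvature α ρ' ∧ lam α ρ' = 0 := by
  obtain ⟨l, hl, hl0⟩ := hc
  rw [← map_zero (Cohomology.mk (centerAction abar) 3), Cohomology.mk_eq_mk_iff] at hl0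
  obtain ⟨μ, hμ⟩ := hl0
  refine ⟨ρ + centerIncl (-μ), hρ.add_centerIncl _, ?_⟩
  rw [lam_add_centerIncl hα, map_neg, hμ, ← hl, ← centerIncl_add]
  simp [centerIncl_zero]

theorem IsClassOf.zero (h0 : lam α ρ = 0) : IsClassOf abar α ρ 0 :=
  ⟨0, by rw [h0]; exact centerIncl_zero, map_zero _⟩

end Obstruction

end LieExt

namespace LieExt

/-! ### The extension built from an admissible pair with `λ = 0` -/

section Twisted

variable {K : Type*} [Field K] {g h : Type*} [LieRing g] [LieAlgebra K g] [LieRing h]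
  [LieAlgebra K h] {α : g →ₗ[K] LieDerivation K h h} {ρ : g [⋀^Fin 2]→ₗ[K] h}

/-- The identity behind the Jacobi identity of `Twisted`. -/
theorem twisted_jacobi (hρ : IsCurvature α ρ) (h0 : lam α ρ = 0) (H₁ H₂ H₃ : h) (X₁ X₂ X₃ : g) :
    ⁅H₁, ⁅H₂, H₃⁆ + α X₂ H₃ - α X₃ H₂ + ρ ![X₂, X₃]⁆ +
        α X₁ (⁅H₂, H₃⁆ + α X₂ H₃ - α X₃ H₂ + ρ ![X₂, X₃]) - α ⁅X₂, X₃⁆ H₁ +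
        ρ ![X₁, ⁅X₂, X₃⁆] =
      ⁅⁅H₁, H₂⁆ + α X₁ H₂ - α X₂ H₁ + ρ ![X₁, X₂], H₃⁆ + α ⁅X₁, X₂⁆ H₃ -
        α X₃ (⁅H₁, H₂⁆ + α X₁ H₂ - α X₂ H₁ + ρ ![X₁, X₂]) + ρ ![⁅X₁, X₂⁆, X₃] +
      (⁅H₂, ⁅H₁, H₃⁆ + α X₁ H₃ - α X₃ H₁ + ρ ![X₁, X₃]⁆ +
        α X₂ (⁅H₁, H₃⁆ + α X₁ H₃ - α X₃ H₁ + ρ ![X₁, X₃]) - α ⁅X₁, X₃⁆ H₂ +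
        ρ ![X₂, ⁅X₁, X₃⁆]) := by
  have hc := isCurvature_iff.mp hρ
  have hl : α X₁ (ρ ![X₂, X₃]) = α X₂ (ρ ![X₁, X₃]) - α X₃ (ρ ![X₁, X₂]) +
      ρ ![⁅X₁, X₂⁆, X₃] - ρ ![⁅X₁, X₃⁆, X₂] + ρ ![⁅X₂, X₃⁆, X₁] := by
    have h1 := lam_apply α ρ X₁ X₂ X₃
    rw [h0, AlternatingMap.zero_apply] at h1
    rw [← sub_eq_zero, h1]
    abel
  simp only [map_add, map_sub, lie_add, lie_sub, add_lie, sub_lie,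
    LieDerivation.apply_lie_eq_add]
  rw [hl, hc X₁ X₂ H₃, hc X₁ X₃ H₂, hc X₂ X₃ H₁, leibniz_lie H₁ H₂ H₃,
    two_swap ρ ⁅X₂, X₃⁆ X₁, two_swap ρ ⁅X₁, X₃⁆ X₂,
    ← lie_skew H₁ (α X₂ H₃), ← lie_skew H₁ (α X₃ H₂), ← lie_skew H₂ (α X₁ H₃),
    ← lie_skew H₂ (α X₃ H₁), ← lie_skew H₁ (ρ ![X₂, X₃]), ← lie_skew H₂ (ρ ![X₁, X₃])]
  abel

/-- The vector space `h × g`, to be equipped with the bracket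
`[(H, X), (H', X')] = ([H, H'] + α_X H' - α_X' H + ρ(X, X'), [X, X'])`. -/
structure Twisted (hρ : IsCurvature α ρ) (h0 : lam α ρ = 0) where
  /-- The component in `h`. -/
  fst : h
  /-- The component in `g`. -/
  snd : g

variable {hρ : IsCurvature α ρ} {h0 : lam α ρ = 0}

namespace Twisted

/-- The underlying bijection with `h × g`. -/
def equivProd (hρ : IsCurvature α ρ) (h0 : lam α ρ = 0) : Twisted hρ h0 ≃ h × g where
  toFun x := (x.fst, x.snd)
  invFun x := ⟨x.1, x.2⟩

instance : AddCommGroup (Twisted hρ h0) := (equivProd hρ h0).addCommGroup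

instance : Module K (Twisted hρ h0) := (equivProd hρ h0).module K

instance : Bracket (Twisted hρ h0) (Twisted hρ h0) where
  bracket x y :=
    ⟨⁅x.fst, y.fst⁆ + α x.snd y.fst - α y.snd x.fst + ρ ![x.snd, y.snd], ⁅x.snd, y.snd⁆⟩

theorem ext {x y : Twisted hρ h0} (h1 : x.fst = y.fst) (h2 : x.snd = y.snd) : x = y :=
  (equivProd hρ h0).injective (Prod.ext h1 h2)

theorem add_fst (x y : Twisted hρ h0) : (x + y).fst = x.fst + y.fst := rfl
theorem add_snd (x y : Twisted hρ h0) : (x + y).snd = x.snd + y.snd := rfl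
theorem smul_fst (c : K) (x : Twisted hρ h0) : (c • x).fst = c • x.fst := rfl
theorem smul_snd (c : K) (x : Twisted hρ h0) : (c • x).snd = c • x.snd := rfl
theorem lie_fst (x y : Twisted hρ h0) :
    ⁅x, y⁆.fst = ⁅x.fst, y.fst⁆ + α x.snd y.fst - α y.snd x.fst + ρ ![x.snd, y.snd] := rfl
theorem lie_snd (x y : Twisted hρ h0) : ⁅x, y⁆.snd = ⁅x.snd, y.snd⁆ := rfl

instance : LieRing (Twisted hρ h0) where
  add_lie x y z := by
    refine ext ?_ (by simp only [lie_snd, add_snd, add_lie])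
    simp only [lie_fst, add_fst, add_snd, add_lie, map_add, LieDerivation.add_apply, two_add_left]
    abel
  lie_add x y z := by
    refine ext ?_ (by simp only [lie_snd, add_snd, lie_add])
    simp only [lie_fst, add_fst, add_snd, lie_add, map_add, LieDerivation.add_apply, two_add_right]
    abel
  lie_self x := by
    refine ext ?_ (lie_self x.snd)
    rw [lie_fst, lie_self, two_self, zero_add, sub_self, add_zero]
    rfl
  -- In the `h`-component, the terms with three arguments from `h` cancel by Jacobi in `h`, with two
  -- by the derivation rule, with one by the curvature equation, and with none by `λ = 0`.
  leibniz_lie x y z :=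
    ext (twisted_jacobi hρ h0 _ _ _ _ _ _) (leibniz_lie x.snd y.snd z.snd)

instance : LieAlgebra K (Twisted hρ h0) where
  lie_smul c x y := by
    refine ext ?_ (by simp only [lie_snd, smul_snd, lie_smul])
    simp only [lie_fst, smul_fst, smul_snd, lie_smul, map_smul, LieDerivation.smul_apply,
      two_smul_right, smul_add, smul_sub]

/-- The inclusion `H ↦ (H, 0)`. -/
def incl (hρ : IsCurvature α ρ) (h0 : lam α ρ = 0) : h →ₗ⁅K⁆ Twisted hρ h0 where
  toFun H := ⟨H, 0⟩
  map_add' _ _ := ext rfl (add_zero _).symm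
  map_smul' _ _ := ext rfl (smul_zero _).symm
  map_lie' {H H'} := by
    refine ext ?_ (lie_self (0 : g)).symm
    change ⁅H, H'⁆ = ⁅H, H'⁆ + α 0 H' - α 0 H + ρ ![0, 0]
    rw [two_self, map_zero, LieDerivation.zero_apply, LieDerivation.zero_apply, add_zero, sub_zero,
      add_zero]

/-- The projection `(H, X) ↦ X`. -/
def proj (hρ : IsCurvature α ρ) (h0 : lam α ρ = 0) : Twisted hρ h0 →ₗ⁅K⁆ g where
  toFun x := x.snd
  map_add' _ _ := rfl
  map_smul' _ _ := rfl
  map_lie' := rfl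

/-- The linear section `X ↦ (0, X)`. -/
def lift (hρ : IsCurvature α ρ) (h0 : lam α ρ = 0) : g →ₗ[K] Twisted hρ h0 where
  toFun X := ⟨0, X⟩
  map_add' _ _ := ext (add_zero _).symm rfl
  map_smul' _ _ := ext (smul_zero _).symm rfl

theorem isExtension (hρ : IsCurvature α ρ) (h0 : lam α ρ = 0) :
    LieAlgebra.IsExtension (incl hρ h0) (proj hρ h0) where
  ker_eq_bot := (LieHom.ker_eq_bot _).mpr fun _ _ e => congrArg Twisted.fst e
  range_eq_top := (LieHom.range_eq_top _).mpr fun X => ⟨lift hρ h0 X, rfl⟩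
  exact := by
    rw [LieHom.range_eq_ker_iff]
    intro x
    constructor
    · intro hx
      exact ⟨x.fst, ext rfl (Eq.symm hx)⟩
    · rintro ⟨H, rfl⟩
      rfl

theorem lift_lie_incl (hρ : IsCurvature α ρ) (h0 : lam α ρ = 0) (X : g) (H : h) :
    ⁅lift hρ h0 X, incl hρ h0 H⁆ = incl hρ h0 (α X H) := by
  refine ext ?_ (lie_zero X)
  change ⁅(0 : h), H⁆ + α X H - α 0 0 + ρ ![X, 0] = α X H
  rw [zero_lie, map_zero, two_zero_right, zero_add, sub_zero, add_zero]

theorem incl_form (hρ : IsCurvature α ρ) (h0 : lam α ρ = 0) (X Y : g) :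
    incl hρ h0 (ρ ![X, Y]) = ⁅lift hρ h0 X, lift hρ h0 Y⁆ - lift hρ h0 ⁅X, Y⁆ := by
  refine ext ?_ (sub_self ⁅X, Y⁆).symm
  change _ = ⁅(0 : h), 0⁆ + α X 0 - α Y 0 + ρ ![X, Y] - 0
  rw [zero_lie, map_zero, map_zero, zero_add, sub_zero, sub_zero, zero_add]
  rfl

/-- The extension of `g` by `h` with datum `(α, ρ)`. -/
def extension (hρ : IsCurvature α ρ) (h0 : lam α ρ = 0) : LieAlgebra.Extension K h g :=
  (isExtension hρ h0).extension

end Twisted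

end Twisted

/-! ### Extensions and their data -/

section Data

universe u v

variable {K : Type*} [Field K] {g : Type u} {h : Type v} [LieRing g] [LieAlgebra K g] [LieRing h]
  [LieAlgebra K h] {abar : g →ₗ⁅K⁆ Out K h} {α : g →ₗ[K] LieDerivation K h h}
  {ρ ρ' : g [⋀^Fin 2]→ₗ[K] h} {E E' : LieAlgebra.Extension K h g}

theorem derOf_eq_iff {x : E.L} {D : LieDerivation K h h} :
    derOf E x = D ↔ ∀ H, ⁅x, E.incl H⁆ = E.incl (D H) := by
  rw [LieDerivation.ext_iff]
  refine forall_congr' fun H => ?_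
  rw [← incl_derOf, E.incl_injective.eq_iff]

theorem derOf_add (x y : E.L) : derOf E (x + y) = derOf E x + derOf E y := by
  rw [derOf_eq_iff]
  intro H
  rw [LieDerivation.add_apply, map_add, incl_derOf, incl_derOf, add_lie]

theorem derOf_smul (c : K) (x : E.L) : derOf E (c • x) = c • derOf E x := by
  rw [derOf_eq_iff]
  intro H
  rw [LieDerivation.smul_apply, map_smul, incl_derOf, smul_lie]

theorem derOf_incl (H : h) : derOf E (E.incl H) = LieDerivation.ad K h H := by
  rw [derOf_eq_iff]
  intro H'
  rw [ad_apply_eq_lie, LieHom.map_lie]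

theorem hasDatum_extension (hρ : IsCurvature α ρ) (h0 : lam α ρ = 0) :
    HasDatum (Twisted.extension hρ h0) α ρ := by
  refine ⟨Twisted.lift hρ h0, fun X => rfl, fun X => derOf_eq_iff.mpr fun H => ?_, fun X Y => ?_⟩
  · exact Twisted.lift_lie_incl hρ h0 X H
  · exact Twisted.incl_form hρ h0 X Y

theorem HasDatum.induces (hα : IsLift abar α) (hE : HasDatum E α ρ) : Induces E abar := by
  obtain ⟨s, hs, hsα, -⟩ := hE
  intro x
  obtain ⟨H, hH⟩ := exists_incl_eq E (x := x - s (E.proj x)) (by rw [map_sub, hs, sub_self])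
  have hx : x = s (E.proj x) + E.incl H := by rw [hH, add_sub_cancel]
  have h1 : (LieSubmodule.Quotient.mk (α (E.proj x) + LieDerivation.ad K h H) : Out K h) =
      LieSubmodule.Quotient.mk (α (E.proj x)) +
        LieSubmodule.Quotient.mk (LieDerivation.ad K h H) := rfl
  rw [congrArg (derOf E) hx, derOf_add, derOf_incl, hsα, h1, hα,
    (LieSubmodule.Quotient.mk_eq_zero' (N := (LieDerivation.ad K h).idealRange)).mpr
      (LieDerivation.mem_ad_idealRange_iff.mpr ⟨H, rfl⟩), add_zero]

theorem HasDatum.isCurvature (hE : HasDatum E α ρ) : IsCurvature α ρ := by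
  obtain ⟨s, hs, hsα, hsρ⟩ := hE
  simp only [derOf_eq_iff] at hsα
  rw [isCurvature_iff]
  intro X Y H
  apply E.incl_injective
  rw [map_add, map_add, LieHom.map_lie, ← hsα, ← hsα, ← hsα, ← hsα, ← hsα, hsρ, sub_lie,
    lie_lie (s X)]
  abel

/-- This is the Jacobi identity for `s(X)`, `s(Y)`, `s(Z)`, read in the `h`-part. -/
theorem HasDatum.lam_eq_zero (hE : HasDatum E α ρ) : lam α ρ = 0 := by
  obtain ⟨s, hs, hsα, hsρ⟩ := hE
  simp only [derOf_eq_iff] at hsα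
  refine three_ext fun X Y Z => E.incl_injective ?_
  simp only [lam_apply, map_add, map_sub, ← hsα, hsρ, AlternatingMap.zero_apply, map_zero, lie_sub]
  rw [leibniz_lie (s X) (s Y) (s Z), ← lie_skew (s Z) ⁅s X, s Y⁆, ← lie_skew (s Z) (s ⁅X, Y⁆),
    ← lie_skew (s Y) (s ⁅X, Z⁆), ← lie_skew (s X) (s ⁅Y, Z⁆), lie_lie_eq_sub X Y Z, map_sub]
  abel

/-- An arbitrary section realizes some lift of `ᾱ`. That lift differs from `α` by `ad_b`, and adding
`i ∘ b` to the section corrects it. -/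
theorem Induces.exists_hasDatum (hE : Induces E abar) (hα : IsLift abar α) :
    ∃ ρ, HasDatum E α ρ := by
  obtain ⟨s, hs⟩ := LinearMap.exists_rightInverse_of_surjective (E.proj : E.L →ₗ[K] g)
    (LinearMap.range_eq_top.mpr E.proj_surjective)
  replace hs (X : g) : E.proj (s X) = X := LinearMap.congr_fun hs X
  let α' : g →ₗ[K] LieDerivation K h h :=
    { toFun X := derOf E (s X)
      map_add' X Y := by rw [map_add, derOf_add]
      map_smul' c X := by rw [map_smul, derOf_smul, RingHom.id_apply] }
  have hα' : IsLift abar α' := fun X => by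
    rw [← congrArg abar (hs X)]
    exact hE (s X)
  obtain ⟨b, rfl⟩ := hα'.exists_shift hα
  let s' : g →ₗ[K] E.L := s + (E.incl : h →ₗ[K] E.L) ∘ₗ b
  have hs'_apply (X : g) : s' X = s X + E.incl (b X) := rfl
  have hs' (X : g) : E.proj (s' X) = X := by
    rw [hs'_apply, map_add, hs, E.proj_incl, add_zero]
  let F : g →ₗ[K] g →ₗ[K] E.L :=
    (LieModule.toEnd K E.L E.L : E.L →ₗ[K] Module.End K E.L).compl₁₂ s' s' -
      (LieModule.toEnd K g g : g →ₗ[K] Module.End K g).compr₂ s'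
  have hF (X Y : g) : F X Y = ⁅s' X, s' Y⁆ - s' ⁅X, Y⁆ := rfl
  -- `F` takes values in `i(h)`, where a linear left inverse of `i` reads off `ρ`.
  obtain ⟨t, ht⟩ := LinearMap.exists_leftInverse_of_injective (E.incl : h →ₗ[K] E.L)
    (LinearMap.ker_eq_bot.mpr E.incl_injective)
  replace ht (H : h) : t (E.incl H) = H := LinearMap.congr_fun ht H
  refine ⟨altOfBilin (F.compr₂ t) fun X => ?_, s', hs', fun X => ?_, fun X Y => ?_⟩
  · rw [LinearMap.compr₂_apply, hF, lie_self, lie_self, map_zero, sub_zero, map_zero]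
  · rw [hs'_apply, derOf_add, derOf_incl]
    rfl
  · obtain ⟨H, hH⟩ := exists_incl_eq E (x := F X Y) (by
      rw [hF, map_sub, LieHom.map_lie, hs', hs', hs', sub_self])
    rw [altOfBilin_apply, LinearMap.compr₂_apply, ← hH, ht, hH, hF]

theorem HasDatum.of_equivalent (hE : HasDatum E α ρ) (hEE' : Equivalent E E') :
    HasDatum E' α ρ := by
  obtain ⟨s, hs, hsα, hsρ⟩ := hE
  obtain ⟨φ, hφi, hφp⟩ := hEE'
  simp only [derOf_eq_iff] at hsα
  refine ⟨(φ : E.L →ₗ[K] E'.L) ∘ₗ s, fun X => (hφp _).trans (hs X),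
    fun X => derOf_eq_iff.mpr fun H => ?_, fun X Y => ?_⟩
  · rw [← hφi, ← hφi, ← hsα, LieHom.map_lie]
    rfl
  · rw [← hφi, hsρ, map_sub, LieHom.map_lie]
    rfl

/-- A section of an extension splits it as a vector space. -/
theorem exists_retraction {s : g →ₗ[K] E.L} (hs : ∀ X, E.proj (s X) = X) :
    ∃ r : E.L →ₗ[K] h, ∀ x, x = E.incl (r x) + s (E.proj x) := by
  obtain ⟨t, ht⟩ := LinearMap.exists_leftInverse_of_injective (E.incl : h →ₗ[K] E.L)
    (LinearMap.ker_eq_bot.mpr E.incl_injective)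
  replace ht (H : h) : t (E.incl H) = H := LinearMap.congr_fun ht H
  refine ⟨t ∘ₗ (LinearMap.id - s ∘ₗ (E.proj : E.L →ₗ[K] g)), fun x => ?_⟩
  obtain ⟨H, hH⟩ := exists_incl_eq E (x := x - s (E.proj x)) (by rw [map_sub, hs, sub_self])
  have h1 : (t ∘ₗ (LinearMap.id - s ∘ₗ (E.proj : E.L →ₗ[K] g))) x = t (x - s (E.proj x)) := rfl
  rw [h1, ← hH, ht, hH, sub_add_cancel]

/-- The bracket of an extension in terms of a datum. -/
theorem lie_incl_add {s : g →ₗ[K] E.L} (hsα : ∀ X, derOf E (s X) = α X)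
    (hsρ : ∀ X Y, E.incl (ρ ![X, Y]) = ⁅s X, s Y⁆ - s ⁅X, Y⁆) (H H' : h) (X X' : g) :
    ⁅E.incl H + s X, E.incl H' + s X'⁆ =
      E.incl (⁅H, H'⁆ + α X H' - α X' H + ρ ![X, X']) + s ⁅X, X'⁆ := by
  simp only [derOf_eq_iff] at hsα
  rw [map_add, map_sub, map_add, LieHom.map_lie, hsρ, ← hsα, ← hsα, ← lie_skew (s X')]
  simp only [add_lie, lie_add]
  abel

/-- The datum determines the whole bracket, so `i(H) + s(X) ↦ i'(H) + s'(X)` is a homomorphism. -/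
theorem HasDatum.equivalent (hE : HasDatum E α ρ) (hE' : HasDatum E' α ρ) : Equivalent E E' := by
  obtain ⟨s, hs, hsα, hsρ⟩ := hE
  obtain ⟨s', hs', hsα', hsρ'⟩ := hE'
  obtain ⟨r, hr⟩ := exists_retraction hs
  let f : E.L →ₗ[K] E'.L :=
    (E'.incl : h →ₗ[K] E'.L) ∘ₗ r + s' ∘ₗ (E.proj : E.L →ₗ[K] g)
  have hf (x : E.L) : f x = E'.incl (r x) + s' (E.proj x) := rfl
  have hr_eq (H : h) (X : g) : r (E.incl H + s X) = H := by
    apply E.incl_injective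
    have h1 := hr (E.incl H + s X)
    rw [map_add E.proj, E.proj_incl, hs, zero_add] at h1
    exact (add_right_cancel h1).symm
  have hf_eq (H : h) (X : g) : f (E.incl H + s X) = E'.incl H + s' X := by
    rw [hf, hr_eq, map_add, E.proj_incl, hs, zero_add]
  refine ⟨{ f with map_lie' := ?_ }, fun H => ?_, fun x => ?_⟩
  · intro x y
    change f ⁅x, y⁆ = ⁅f x, f y⁆
    rw [hr x, hr y, lie_incl_add hsα hsρ, hf_eq, hf_eq, hf_eq, lie_incl_add hsα' hsρ']
  · have h1 := hf_eq H 0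
    rwa [map_zero, map_zero, add_zero, add_zero] at h1
  · change E'.proj (f x) = E.proj x
    rw [hf, map_add, E'.proj_incl, hs', zero_add]

/-- Moving the section by a central `b` preserves `α`, and the quadratic term `[b(X), b(Y)]`
vanishes. -/
theorem HasDatum.add_coboundary (hα : IsLift abar α) (hE : HasDatum E α ρ)
    (φ : g [⋀^Fin 1]→ₗ[K] LieAlgebra.center K h) :
    HasDatum E α (ρ + centerIncl (covD (centerAction abar) 1 φ)) := by
  obtain ⟨b, rfl⟩ := exists_altOfLinear_eq φ
  obtain ⟨s, hs, hsα, hsρ⟩ := hE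
  simp only [derOf_eq_iff] at hsα
  let b' : g →ₗ[K] h := (LieAlgebra.center K h).toSubmodule.subtype ∘ₗ b
  let s' : g →ₗ[K] E.L := s + (E.incl : h →ₗ[K] E.L) ∘ₗ b'
  have hs' (X : g) : s' X = s X + E.incl (b X) := rfl
  refine ⟨s', fun X => ?_, fun X => derOf_eq_iff.mpr fun H => ?_, fun X Y => ?_⟩
  · rw [hs', map_add, hs, E.proj_incl, add_zero]
  · rw [hs', add_lie, hsα, ← LieHom.map_lie, center_lie, map_zero, add_zero]
  · rw [AlternatingMap.add_apply, centerIncl_covD hα, covD_one_apply]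
    have hb (X : g) : centerIncl (altOfLinear b) ![X] = (b X : h) := rfl
    simp only [hb, hs', derEnd_apply, map_add, map_sub, hsρ, ← hsα, add_lie, lie_add]
    rw [← LieHom.map_lie, lie_center, map_zero, ← lie_skew (s Y)]
    abel

/-- Two sections inducing the same `α` differ by elements of `i(h)` that commute with `i(h)`, hence
by a central linear map. -/
theorem HasDatum.exists_coboundary (hα : IsLift abar α) (hE : HasDatum E α ρ)
    (hE' : HasDatum E α ρ') :
    ∃ φ, ρ' = ρ + centerIncl (covD (centerAction abar) 1 φ) := by
  obtain ⟨s, hs, hsα, hsρ⟩ := hE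
  obtain ⟨s', hs', hsα', hsρ'⟩ := hE'
  obtain ⟨r, hr⟩ := exists_retraction hs
  have hb (X : g) : E.incl (r (s' X)) = s' X - s X := by
    have h1 := hr (s' X)
    rw [hs'] at h1
    rw [eq_sub_iff_add_eq]
    exact h1.symm
  simp only [derOf_eq_iff] at hsα hsα'
  let b : g →ₗ[K] LieAlgebra.center K h :=
    (r ∘ₗ s').codRestrict (LieAlgebra.center K h).toSubmodule fun X => mem_center_iff.mpr fun H => by
      apply E.incl_injective
      rw [LieHom.map_lie, LinearMap.comp_apply, hb, lie_sub, ← lie_skew, hsα', ← lie_skew, hsα,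
        sub_self, map_zero]
  have hb' (X : g) : centerIncl (altOfLinear b) ![X] = r (s' X) := rfl
  refine ⟨altOfLinear b, two_ext fun X Y => E.incl_injective ?_⟩
  -- This quadratic term, expanded in `s` and `s'`, is exactly the discrepancy between the two
  -- sides.
  have hX : ⁅E.incl (r (s' X)), E.incl (r (s' Y))⁆ = 0 := by
    rw [← LieHom.map_lie]
    exact (congrArg E.incl (lie_center (b Y) _)).trans (map_zero _)
  rw [hb, hb, sub_lie, lie_sub, lie_sub] at hX
  rw [AlternatingMap.add_apply, centerIncl_covD hα, covD_one_apply]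
  simp only [hb', derEnd_apply, map_add, map_sub, hsρ, hsρ', ← hsα, hb, lie_sub]
  rw [← lie_skew (s Y) (s' X), ← lie_skew (s Y) (s X), ← sub_eq_zero, ← hX]
  abel

end Data
end LieExt

namespace LieExt

/-! ### Equivalence classes of extensions and `H^2` -/

section Parametrization

universe u v

variable {K : Type*} [Field K] {g : Type u} {h : Type v} [LieRing g] [LieAlgebra K g] [LieRing h]
  [LieAlgebra K h] {abar : g →ₗ⁅K⁆ Out K h} {α : g →ₗ[K] LieDerivation K h h}
  {ρ : g [⋀^Fin 2]→ₗ[K] h}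

theorem exists_inducingExtension (hα : IsLift abar α) (hρ : IsCurvature α ρ)
    (h0 : lam α ρ = 0) : ∃ E : InducingExtension abar, HasDatum E.1 α ρ :=
  ⟨⟨Twisted.extension hρ h0, (hasDatum_extension hρ h0).induces hα⟩, hasDatum_extension hρ h0⟩

theorem exists_hasDatum_sub_cocycle (hα : IsLift abar α) (hρ : IsCurvature α ρ)
    (h0 : lam α ρ = 0) (μ : cocycles (centerAction abar) 2) :
    ∃ E : InducingExtension abar, HasDatum E.1 α (ρ - centerIncl μ.1) := by
  have h1 : ρ - centerIncl μ.1 = ρ + centerIncl (-μ).1 := by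
    ext v
    simp [sub_eq_add_neg]
  rw [h1]
  refine exists_inducingExtension hα (hρ.add_centerIncl _) ?_
  rw [lam_add_centerIncl hα, h0, LinearMap.mem_ker.mp (-μ).2, centerIncl_zero, add_zero]

theorem exists_cocycle_hasDatum (hα : IsLift abar α) (hρ : IsCurvature α ρ)
    (h0 : lam α ρ = 0) (E : InducingExtension abar) :
    ∃ μ : cocycles (centerAction abar) 2, HasDatum E.1 α (ρ - centerIncl μ.1) := by
  obtain ⟨ρ', hE⟩ := Induces.exists_hasDatum E.2 hα
  obtain ⟨μ, rfl⟩ := hρ.exists_eq_add hE.isCurvature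
  have h1 : covD (centerAction abar) 2 μ = 0 := by
    apply centerIncl_injective
    rw [centerIncl_zero, ← hE.lam_eq_zero, lam_add_centerIncl hα, h0, zero_add]
  refine ⟨-⟨μ, h1⟩, ?_⟩
  convert hE using 1
  ext v
  simp

theorem exists_cohomology_equiv (hα : IsLift abar α) (hρ : IsCurvature α ρ)
    (h0 : lam α ρ = 0) :
    ∃ Φ : Cohomology (centerAction abar) 2 ≃ Quotient (inducingSetoid abar),
      ∀ (μ : cocycles (centerAction abar) 2) (E : InducingExtension abar),
        Φ (Cohomology.mk (centerAction abar) 2 μ) = Quotient.mk _ E ↔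
          HasDatum E.1 α (ρ - centerIncl μ.1) := by
  choose F hF using exists_hasDatum_sub_cocycle hα hρ h0
  have hF_iff (μ : cocycles (centerAction abar) 2) (E : InducingExtension abar) :
      Quotient.mk (inducingSetoid abar) (F μ) = Quotient.mk _ E ↔
        HasDatum E.1 α (ρ - centerIncl μ.1) :=
    Quotient.eq.trans ⟨fun e => (hF μ).of_equivalent e, fun e => (hF μ).equivalent e⟩
  have hclass (μ ν : cocycles (centerAction abar) 2) :
      Cohomology.mk (centerAction abar) 2 μ = Cohomology.mk (centerAction abar) 2 ν ↔
        Quotient.mk (inducingSetoid abar) (F μ) = Quotient.mk _ (F ν) := by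
    rw [hF_iff, Cohomology.mk_eq_mk_iff]
    constructor
    · rintro ⟨φ, hφ⟩
      -- The sign appears because cocycles are subtracted from `ρ`: `ρ - ν - δφ = ρ - μ`.
      convert (hF ν).add_coboundary hα (-φ) using 1
      rw [map_neg, hφ, neg_sub, centerIncl_sub]
      abel
    · intro e
      obtain ⟨φ, hφ⟩ := e.exists_coboundary hα (hF ν)
      refine ⟨φ, centerIncl_injective ?_⟩
      rw [centerIncl_sub, ← sub_eq_zero]
      rw [← sub_eq_zero] at hφ
      rw [← neg_eq_zero, ← hφ]
      abel
  let f : Cohomology (centerAction abar) 2 → Quotient (inducingSetoid abar) :=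
    Quotient.lift (fun μ => Quotient.mk _ (F μ)) fun μ ν e => (hclass μ ν).mp (Quotient.sound e)
  have hf (μ : cocycles (centerAction abar) 2) :
      f (Cohomology.mk (centerAction abar) 2 μ) = Quotient.mk _ (F μ) := rfl
  have hmk : Function.Surjective (Cohomology.mk (centerAction abar) 2) :=
    Submodule.mkQ_surjective _
  refine ⟨Equiv.ofBijective f ⟨fun x y e => ?_, fun y => ?_⟩, hF_iff⟩
  · obtain ⟨μ, rfl⟩ := hmk x
    obtain ⟨ν, rfl⟩ := hmk y
    exact (hclass μ ν).mpr e
  · obtain ⟨E, rfl⟩ := Quotient.exists_rep y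
    obtain ⟨μ, hμ⟩ := exists_cocycle_hasDatum hα hρ h0 E
    exact ⟨Cohomology.mk (centerAction abar) 2 μ, (hF_iff μ E).mpr hμ⟩

end Parametrization

end LieExt
theorem theorem8 {K : Type*} [Field K] {g : Type*} {h : Type*} [LieRing g] [LieAlgebra K g]
    [LieRing h] [LieAlgebra K h] (abar : g →ₗ⁅K⁆ LieExt.Out K h) :
    -- linear lifts exist, and every lift admits a suitable `ρ`
    (∃ α : g →ₗ[K] LieDerivation K h h, LieExt.IsLift abar α) ∧
    (∀ α : g →ₗ[K] LieDerivation K h h, LieExt.IsLift abar α →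
      ∃ ρ : g [⋀^Fin 2]→ₗ[K] h, LieExt.IsCurvature α ρ) ∧
    -- `λ = δ_α ρ` takes values in `Z(h)`
    (∀ (α : g →ₗ[K] LieDerivation K h h) (ρ : g [⋀^Fin 2]→ₗ[K] h),
      LieExt.IsLift abar α → LieExt.IsCurvature α ρ →
      ∀ v : Fin 3 → g, LieExt.lam α ρ v ∈ LieAlgebra.center K h) ∧
    -- it is a cocycle, and its class in `H^3(g; Z(h))` does not depend on the choices
    (∃! c : LieExt.Cohomology (LieExt.centerAction abar) 3,
      ∀ (α : g →ₗ[K] LieDerivation K h h) (ρ : g [⋀^Fin 2]→ₗ[K] h),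
        LieExt.IsLift abar α → LieExt.IsCurvature α ρ → LieExt.IsClassOf abar α ρ c) ∧
    -- vanishing of the class for one choice, for every choice, and existence of an extension
    [∃ (α : g →ₗ[K] LieDerivation K h h) (ρ : g [⋀^Fin 2]→ₗ[K] h),
        LieExt.IsLift abar α ∧ LieExt.IsCurvature α ρ ∧ LieExt.IsClassOf abar α ρ 0,
      ∀ (α : g →ₗ[K] LieDerivation K h h) (ρ : g [⋀^Fin 2]→ₗ[K] h),
        LieExt.IsLift abar α → LieExt.IsCurvature α ρ → LieExt.IsClassOf abar α ρ 0,
      Nonempty (LieExt.InducingExtension abar)].TFAE ∧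
    -- the parametrization of the equivalence classes of extensions by `H^2(g; Z(h))`
    (Nonempty (LieExt.InducingExtension abar) →
      (∀ α : g →ₗ[K] LieDerivation K h h, LieExt.IsLift abar α →
        ∃ ρ : g [⋀^Fin 2]→ₗ[K] h, LieExt.IsCurvature α ρ ∧ LieExt.lam α ρ = 0) ∧
      ∀ (α : g →ₗ[K] LieDerivation K h h) (ρ : g [⋀^Fin 2]→ₗ[K] h),
        LieExt.IsLift abar α → LieExt.IsCurvature α ρ → LieExt.lam α ρ = 0 →
        ∃ Φ : LieExt.Cohomology (LieExt.centerAction abar) 2 ≃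
            Quotient (LieExt.inducingSetoid abar),
          ∀ (μ : LieExt.cocycles (LieExt.centerAction abar) 2) (E : LieExt.InducingExtension abar),
            Φ (LieExt.Cohomology.mk (LieExt.centerAction abar) 2 μ) = Quotient.mk _ E ↔
              LieExt.HasDatum E.1 α (ρ - LieExt.centerIncl μ.1)) := by
  refine ⟨LieExt.exists_isLift abar, fun α hα => hα.exists_isCurvature,
    fun α ρ _ hρ => LieExt.lam_mem_center hρ, ?_, ?_, ?_⟩
  · obtain ⟨α, hα⟩ := LieExt.exists_isLift abar
    obtain ⟨ρ, hρ⟩ := hα.exists_isCurvature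
    obtain ⟨c, hc⟩ := LieExt.exists_isClassOf hα hρ
    exact ⟨c, fun α' ρ' hα' hρ' => hc.of_admissible hα hρ hα' hρ',
      fun c' hc' => (hc' α ρ hα hρ).unique hc⟩
  · tfae_have 1 → 2 := by
      rintro ⟨α, ρ, hα, hρ, hc⟩ α' ρ' hα' hρ'
      exact hc.of_admissible hα hρ hα' hρ'
    tfae_have 2 → 3 := by
      intro H
      obtain ⟨α, hα⟩ := LieExt.exists_isLift abar
      obtain ⟨ρ, hρ⟩ := hα.exists_isCurvature
      -- The class vanishes but `λ` need not, so `ρ` is corrected before the extension is built.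
      obtain ⟨ρ', hρ', h0⟩ := (H α ρ hα hρ).exists_lam_eq_zero hα hρ
      obtain ⟨E, -⟩ := LieExt.exists_inducingExtension hα hρ' h0
      exact ⟨E⟩
    tfae_have 3 → 1 := by
      rintro ⟨E⟩
      obtain ⟨α, hα⟩ := LieExt.exists_isLift abar
      obtain ⟨ρ, hE⟩ := LieExt.Induces.exists_hasDatum E.2 hα
      exact ⟨α, ρ, hα, hE.isCurvature, LieExt.IsClassOf.zero hE.lam_eq_zero⟩
    tfae_finish
  · rintro ⟨E⟩
    refine ⟨fun α hα => ?_, fun α ρ hα hρ h0 => LieExt.exists_cohomology_equiv hα hρ h0⟩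
    obtain ⟨ρ, hE⟩ := LieExt.Induces.exists_hasDatum E.2 hα
    exact ⟨ρ, hE.isCurvature, hE.lam_eq_zero⟩
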